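/- For an integer $n$ and $p\in[0,1]$ let $G(n,n,p)$ be the random bipartite graph with sides $U=\{u_1,\dots,u_n\}$ and $V=\{v_1,\dots,v_n\}$ in which each pair $(u_i,v_j)$ is an edge independently with probability $p$. Equip its $2n$ vertices with the shortest-path metric $d$ (with $d(x,y)=\infty$ if $x$ and $y$ lie in different components). A map $g$ from the vertices to $\mathbb R^s$ is an embedding into $\ell_\infty$ of dimension $s$ with distortion $c$ if, for some $r>0$, $r\,d(x,y)\le\|g(x)-g(y)\|_\infty\le c\,r\,d(x,y)$ for all vertices $x,y$. There is an absolute constant $B\in\mathbb N$ such that for every $\varepsilon>0$ there is a constant $C>0$ (depending only on $\varepsilon$) with the following property. For every $\eta>0$ there is $N$ such that for all $n\ge N$, all integers $k\ge 1$ and all real $c$ with $(1+\varepsilon)c\le 2k+1$: if $$p=\frac{n^{-1+1/(2k-1)}}{\log_2^5 n},$$ then with probability at least $1-\eta$ over $G(n,n,p)$, every embedding of the shortest-path metric into $\ell_\infty$ with distortion $c$ has dimension $$s\ \ge\ C\,\frac{n^{1/(2k-1)}}{\log_2^B n}.$$ In particular, for fixed $k\ge1$ and $c<2k+1$, with probability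 $1-o(1)$ as $n\to\infty$ any distortion-$c$ embedding requires dimension $\tilde\Omega(n^{1/(2k-1)})$. -/

import Mathlib

open scoped ENNReal

/-- The bipartite graph on the vertex set `U ⊔ V`, `U = {u_1, …, u_n}` (left summand) and
`V = {v_1, …, v_n}` (right summand), in which `u_i` and `v_j` are adjacent iff `(i, j) ∈ E`. -/
def bipartiteGraph (n : ℕ) (E : Set (Fin n × Fin n)) : SimpleGraph (Fin n ⊕ Fin n) where
  Adj x y := ∃ i j, (i, j) ∈ E ∧
    ((x = Sum.inl i ∧ y = Sum.inr j) ∨ (x = Sum.inr j ∧ y = Sum.inl i))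
  symm := by
    constructor
    rintro x y ⟨i, j, hE, h⟩
    exact ⟨i, j, hE, by tauto⟩
  loopless := by
    constructor
    rintro x ⟨i, j, -, ⟨h₁, h₂⟩ | ⟨h₁, h₂⟩⟩ <;> simp [h₁] at h₂

/-- The law of the edge set of the random bipartite graph `G(n, n, p)`: each of the `n ^ 2` pairs
`(i, j)` is included independently with probability `p`. -/
noncomputable def randomBipartiteEdges (n : ℕ) (p : unitInterval) :
    MeasureTheory.Measure (Set (Fin n × Fin n)) :=
  ProbabilityTheory.setBernoulli Set.univ p

/-- The shortest-path metric of a graph: the length of a shortest path between `x` and `y`, or `∞`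
if `x` and `y` are disconnected. -/
noncomputable def shortestPathDist {X : Type*} (G : SimpleGraph X) (x y : X) : ℝ≥0∞ :=
  (G.edist x y : ℝ≥0∞)

/-- `g` embeds the (extended) metric `d` into `ℓ_∞^s` with distortion `c`: up to a scaling factor
`r > 0`, it does not contract any distance and expands every distance at most `c` times.
(`Fin s → ℝ` carries the maximum norm.) -/
def IsEmbeddingWithDistortion {X : Type*} (d : X → X → ℝ≥0∞) (c : ℝ) {s : ℕ}
    (g : X → Fin s → ℝ) : Prop :=
  ∃ r : ℝ, 0 < r ∧ ∀ x y : X,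
    ENNReal.ofReal r * d x y ≤ edist (g x) (g y) ∧
      edist (g x) (g y) ≤ ENNReal.ofReal (c * r) * d x y

/-! Scale so that edges have length at most `c * r` in every coordinate, strictly below `τ = (2k+1)
r`. By parity, a pair `(u_i, v_j)` without a path of length at most `2k-1` is at distance at least
`2k+1`, so some coordinate separates it by at least `τ`. In one coordinate, and for one sign, the
pairs so separated form a half graph (nested neighbourhoods) containing no edge of `E`. If `E` meets
every `L × L` block, such a half graph has only `O(Ln)` pairs (`card_halfGraph_le`). Small degrees
leave at least half of the `n²` pairs far apart, so `s ≥ n / (8L)` (`dimension_lower_bound`).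

With high probability degrees are below about `np log n` and `L ≈ 3 log n / p` works, whence `s ≥ np
/ (32 log n)`, with logarithms to base 2. -/

/-! ### Union bounds for the random edge set -/

open MeasureTheory in
lemma setBernoulli_real_superset {ι : Type*} (p : unitInterval) (T : Finset ι) :
    (ProbabilityTheory.setBernoulli (Set.univ : Set ι) p).real {E | ∀ i ∈ T, i ∈ E}
      = (p : ℝ) ^ T.card := by
  rw [measureReal_def, ProbabilityTheory.setBernoulli_apply']
  have : ((fun q : ι → Prop ↦ {i | q i}) ⁻¹' {E | ∀ i ∈ T, i ∈ E})
      = Set.pi (T : Set ι) (fun _ ↦ {True}) := by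
    ext q; simp [Set.mem_pi]
  rw [this, Measure.infinitePi_pi _ (fun _ _ ↦ MeasurableSet.of_discrete)]
  simp

open MeasureTheory in
lemma setBernoulli_real_disjoint {ι : Type*} (p : unitInterval) (T : Finset ι) :
    (ProbabilityTheory.setBernoulli (Set.univ : Set ι) p).real {E | ∀ i ∈ T, i ∉ E}
      = (1 - p : ℝ) ^ T.card := by
  rw [measureReal_def, ProbabilityTheory.setBernoulli_apply']
  have : ((fun q : ι → Prop ↦ {i | q i}) ⁻¹' {E | ∀ i ∈ T, i ∉ E})
      = Set.pi (T : Set ι) (fun _ ↦ {False}) := by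
    ext q; simp [Set.mem_pi]
  rw [this, Measure.infinitePi_pi _ (fun _ _ ↦ MeasurableSet.of_discrete)]
  simp

open MeasureTheory in
lemma setBernoulli_real_exists_subset_le {ι β : Type*} [Fintype β] (p : unitInterval)
    (f : β ↪ ι) (t : ℕ) :
    (ProbabilityTheory.setBernoulli (Set.univ : Set ι) p).real
      {E | ∃ T : Finset β, T.card = t ∧ ∀ b ∈ T, f b ∈ E}
      ≤ ((Fintype.card β).choose t : ℝ) * (p : ℝ) ^ t := by
  set μ := ProbabilityTheory.setBernoulli (Set.univ : Set ι) p
  have h : {E | ∃ T : Finset β, T.card = t ∧ ∀ b ∈ T, f b ∈ E}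
      = ⋃ T ∈ (Finset.univ : Finset β).powersetCard t, {E : Set ι | ∀ i ∈ T.map f, i ∈ E} := by
    ext E; simp [Finset.mem_powersetCard]
  rw [h]
  refine (measureReal_biUnion_finset_le _ _).trans ?_
  rw [Finset.sum_congr rfl (g := fun _ ↦ (p : ℝ) ^ t)]
  · simp [Finset.card_powersetCard]
  · intro T hT
    rw [setBernoulli_real_superset, Finset.card_map, (Finset.mem_powersetCard.1 hT).2]

open MeasureTheory in
/-- Union bound for the existence of an edge-free `L × L` block. -/
lemma randomBipartiteEdges_real_empty_block_le (n L : ℕ) (p : unitInterval) :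
    (randomBipartiteEdges n p).real
      {E | ∃ A B : Finset (Fin n), A.card = L ∧ B.card = L ∧ ∀ i ∈ A, ∀ j ∈ B, (i, j) ∉ E}
      ≤ (n.choose L : ℝ) ^ 2 * (1 - p : ℝ) ^ (L ^ 2) := by
  have h : {E : Set (Fin n × Fin n) | ∃ A B : Finset (Fin n), A.card = L ∧ B.card = L ∧
        ∀ i ∈ A, ∀ j ∈ B, (i, j) ∉ E}
      = ⋃ T ∈ (Finset.univ : Finset (Fin n)).powersetCard L ×ˢ
          (Finset.univ : Finset (Fin n)).powersetCard L,
          {E : Set (Fin n × Fin n) | ∀ i ∈ T.1 ×ˢ T.2, i ∉ E} := by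
    ext E
    simp only [Set.mem_ofPred_eq, Set.mem_iUnion, Finset.mem_product, Finset.mem_powersetCard,
      Finset.subset_univ, true_and, Prod.forall, exists_prop, Prod.exists]
    constructor
    · rintro ⟨A, B, hA, hB, h⟩
      exact ⟨A, B, ⟨hA, hB⟩, fun i j hij ↦ h i hij.1 j hij.2⟩
    · rintro ⟨A, B, ⟨hA, hB⟩, h⟩
      exact ⟨A, B, hA, hB, fun i hi j hj ↦ h i j ⟨hi, hj⟩⟩
  rw [h]
  refine (measureReal_biUnion_finset_le _ _).trans ?_
  rw [Finset.sum_congr rfl (g := fun _ ↦ (1 - p : ℝ) ^ (L ^ 2))]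
  · simp [Finset.card_powersetCard, sq]
  · intro T hT
    rw [Finset.mem_product, Finset.mem_powersetCard, Finset.mem_powersetCard] at hT
    rw [randomBipartiteEdges, setBernoulli_real_disjoint, Finset.card_product, hT.1.2, hT.2.2, sq]

/-! ### Half graphs, balls and parity -/

/-- A half graph without an `L × L` block has at most `2 L n` pairs. -/
lemma card_halfGraph_le {n L : ℕ} (hL : 1 ≤ L) (a b : Fin n → ℝ) (τ : ℝ)
    (h : ∀ A B : Finset (Fin n), A.card = L → B.card = L → ∃ i ∈ A, ∃ j ∈ B, ¬ τ ≤ a i - b j) :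
    (Finset.univ.filter fun q : Fin n × Fin n ↦ τ ≤ a q.1 - b q.2).card ≤ 2 * L * n := by
  classical
  set nb : Fin n → Finset (Fin n) := fun j ↦ Finset.univ.filter fun i ↦ τ ≤ a i - b j with hnb
  set W : Finset (Fin n) := Finset.univ.filter fun j ↦ L ≤ (nb j).card with hW
  have hWL : W.card ≤ L := by
    by_contra! hlt
    obtain ⟨B, hBW, hB⟩ := Finset.exists_subset_card_eq hlt.le
    -- The columns are nested: the one with the largest `b` is contained in the others, so `L` of
    -- its rows give a full `L × L` block.
    obtain ⟨j₀, hj₀, hmax⟩ := B.exists_max_image b (Finset.card_pos.1 (by omega))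
    obtain ⟨A, hA, hAc⟩ := Finset.exists_subset_card_eq (Finset.mem_filter.1 (hBW hj₀)).2
    obtain ⟨i, hi, j, hj, hij⟩ := h A B hAc hB
    have h1 := (Finset.mem_filter.1 (hA hi)).2
    have h2 := hmax j hj
    exact hij (by linarith)
  have hsum : (Finset.univ.filter fun q : Fin n × Fin n ↦ τ ≤ a q.1 - b q.2).card
      = ∑ j, (nb j).card := by
    rw [Finset.card_eq_sum_card_fiberwise (f := Prod.snd) (t := Finset.univ) (by simp)]
    refine Finset.sum_congr rfl fun j _ ↦ ?_
    refine Finset.card_bij' (fun q _ ↦ q.1) (fun i _ ↦ (i, j)) ?_ ?_ ?_ ?_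
    · rintro ⟨i, j'⟩ hq
      simp only [Finset.mem_filter, Finset.mem_univ, true_and, hnb] at hq ⊢
      rw [← hq.2]; exact hq.1
    · intro i hi
      simpa [hnb] using hi
    · rintro ⟨i, j'⟩ hq
      simp only [Finset.mem_filter, Finset.mem_univ, true_and] at hq
      rw [← hq.2]
    · simp
  rw [hsum]
  calc ∑ j, (nb j).card ≤ ∑ j, ((if j ∈ W then n else 0) + L) := by
        refine Finset.sum_le_sum fun j _ ↦ ?_
        split_ifs with hj
        · exact (Finset.card_le_univ _).trans (by simp)
        · have : ¬ L ≤ (nb j).card := fun h' ↦ hj (by simpa [hW] using h')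
          omega
    _ = W.card * n + n * L := by
        rw [Finset.sum_add_distrib, Finset.sum_ite_mem, Finset.univ_inter]
        simp
    _ ≤ 2 * L * n := by nlinarith

/-- Counting closed neighbourhoods (degree plus one) lets a walk stay in place, so that walks
shorter than `m` are included in the bound. -/
lemma SimpleGraph.ncard_walk_length_le {X : Type*} [Finite X] (G : SimpleGraph X) (t : ℕ)
    (ht : ∀ x, (G.neighborSet x).ncard + 1 ≤ t) (m : ℕ) (x : X) :
    {y | ∃ w : G.Walk x y, w.length ≤ m}.ncard ≤ t ^ m := by
  classical
  have := Fintype.ofFinite X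
  induction m generalizing x with
  | zero =>
    rw [pow_zero, ← Set.ncard_singleton x]
    refine Set.ncard_le_ncard ?_ (Set.toFinite _)
    rintro y ⟨w, hw⟩
    exact (SimpleGraph.Walk.eq_of_length_eq_zero (Nat.le_zero.1 hw)).symm
  | succ m ih =>
    set N : Finset X := (insert x (G.neighborSet x)).toFinset
    have hN : N.card ≤ t := by
      rw [← Set.ncard_eq_toFinset_card']
      exact (Set.ncard_insert_le _ _).trans (ht x)
    have hsub : {y | ∃ w : G.Walk x y, w.length ≤ m + 1}
        ⊆ ⋃ z ∈ N, {y | ∃ w : G.Walk z y, w.length ≤ m} := by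
      rintro y ⟨w, hw⟩
      simp only [Set.mem_iUnion]
      cases w with
      | nil => exact ⟨x, by simp [N], SimpleGraph.Walk.nil, by simp⟩
      | cons hadj w =>
        refine ⟨_, ?_, w, by simpa using hw⟩
        simp [N, hadj]
    calc _ ≤ (⋃ z ∈ N, {y | ∃ w : G.Walk z y, w.length ≤ m}).ncard :=
          Set.ncard_le_ncard hsub (Set.toFinite _)
      _ ≤ ∑ z ∈ N, {y | ∃ w : G.Walk z y, w.length ≤ m}.ncard :=
          Finset.set_ncard_biUnion_le _ _
      _ ≤ ∑ z ∈ N, t ^ m := Finset.sum_le_sum fun z _ ↦ ih z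
      _ = N.card * t ^ m := by simp
      _ ≤ t ^ (m + 1) := by rw [pow_succ']; gcongr

lemma bipartiteGraph_odd_length {n : ℕ} {E : Set (Fin n × Fin n)} {i j : Fin n}
    (w : (bipartiteGraph n E).Walk (Sum.inl i) (Sum.inr j)) : Odd w.length := by
  let C : (bipartiteGraph n E).Coloring Bool := SimpleGraph.Coloring.mk Sum.isLeft (by
    rintro x y ⟨i, j, -, ⟨rfl, rfl⟩ | ⟨rfl, rfl⟩⟩ <;> simp)
  rw [C.odd_length_iff_not_congr]
  simp [C, SimpleGraph.Coloring.mk]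

/-- Walks between opposite sides are odd, so the distance skips `2k`; this gap is what allows
distortion up to `2k+1`. -/
lemma le_shortestPathDist_of_no_walk {n k : ℕ} {E : Set (Fin n × Fin n)} {i j : Fin n} (hk : 1 ≤ k)
    (h : ¬ ∃ w : (bipartiteGraph n E).Walk (Sum.inl i) (Sum.inr j), w.length ≤ 2 * k - 1) :
    ((2 * k + 1 : ℕ) : ℝ≥0∞) ≤
      shortestPathDist (bipartiteGraph n E) (Sum.inl i) (Sum.inr j) := by
  have h' : ((2 * k + 1 : ℕ) : ℕ∞) ≤ (bipartiteGraph n E).edist (Sum.inl i) (Sum.inr j) := by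
    by_contra! hlt
    obtain ⟨w, hw⟩ := SimpleGraph.exists_walk_of_edist_ne_top (ne_top_of_lt hlt)
    rw [← hw, Nat.cast_lt] at hlt
    obtain ⟨q, hq⟩ := bipartiteGraph_odd_length w
    exact h ⟨w, by omega⟩
  unfold shortestPathDist
  exact_mod_cast ENat.toENNReal_le.2 h'

/-! ### The deterministic bound -/

/-- The deterministic part: small degrees and no edge-free `L × L` block force a large dimension. -/
lemma dimension_lower_bound {n k t L s : ℕ} {c : ℝ} {E : Set (Fin n × Fin n)} (hk : 1 ≤ k)
    (hc : c < 2 * k + 1) (hL : 1 ≤ L)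
    (hdeg : ∀ x, ((bipartiteGraph n E).neighborSet x).ncard + 1 ≤ t)
    (hblock : ∀ A B : Finset (Fin n), A.card = L → B.card = L → ∃ i ∈ A, ∃ j ∈ B, (i, j) ∈ E)
    (ht : 2 * t ^ (2 * k - 1) ≤ n) (g : Fin n ⊕ Fin n → Fin s → ℝ)
    (hg : IsEmbeddingWithDistortion (shortestPathDist (bipartiteGraph n E)) c g) :
    n ≤ s * (8 * L) := by
  classical
  obtain ⟨r, hr, hg⟩ := hg
  rcases Nat.eq_zero_or_pos n with rfl | hn
  · simp
  set τ : ℝ := (2 * k + 1) * r with hτ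
  have hτ0 : 0 < τ := by positivity
  have hedge : ∀ i j, (i, j) ∈ E → ∀ q, |g (Sum.inl i) q - g (Sum.inr j) q| < τ := by
    intro i j hij q
    have hadj : (bipartiteGraph n E).Adj (Sum.inl i) (Sum.inr j) := ⟨i, j, hij, by simp⟩
    have h1 := (hg (Sum.inl i) (Sum.inr j)).2
    rw [shortestPathDist, SimpleGraph.edist_eq_one_iff_adj.2 hadj] at h1
    have h2 : edist (g (Sum.inl i)) (g (Sum.inr j)) < ENNReal.ofReal τ := by
      refine h1.trans_lt ?_
      rw [ENat.toENNReal_one, mul_one]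
      exact (ENNReal.ofReal_lt_ofReal_iff hτ0).2 (mul_lt_mul_of_pos_right hc hr)
    rw [edist_lt_ofReal, dist_pi_lt_iff hτ0] at h2
    simpa [Real.dist_eq] using h2 q
  have hfar : ∀ i j, (¬ ∃ w : (bipartiteGraph n E).Walk (Sum.inl i) (Sum.inr j),
      w.length ≤ 2 * k - 1) → ∃ q, τ ≤ |g (Sum.inl i) q - g (Sum.inr j) q| := by
    intro i j hij
    by_contra! hlt
    have h2 : edist (g (Sum.inl i)) (g (Sum.inr j)) < ENNReal.ofReal τ := by
      rw [edist_lt_ofReal, dist_pi_lt_iff hτ0]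
      simpa [Real.dist_eq] using hlt
    refine h2.not_ge (le_trans ?_ (hg (Sum.inl i) (Sum.inr j)).1)
    rw [hτ, mul_comm, ENNReal.ofReal_mul hr.le]
    gcongr
    refine le_trans (le_of_eq ?_) (le_shortestPathDist_of_no_walk hk hij)
    rw [← ENNReal.ofReal_natCast]; push_cast; rfl
  set near : Finset (Fin n × Fin n) := Finset.univ.filter fun q ↦
    ∃ w : (bipartiteGraph n E).Walk (Sum.inl q.1) (Sum.inr q.2), w.length ≤ 2 * k - 1 with hnear
  have hnear_card : near.card ≤ n * t ^ (2 * k - 1) := by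
    rw [Finset.card_eq_sum_card_fiberwise (f := Prod.fst) (t := Finset.univ) (by simp)]
    refine (Finset.sum_le_card_nsmul _ _ (t ^ (2 * k - 1)) fun i _ ↦ ?_).trans (by simp)
    refine le_trans ?_ ((bipartiteGraph n E).ncard_walk_length_le t hdeg (2 * k - 1) (Sum.inl i))
    rw [← Set.ncard_coe_finset]
    refine Set.ncard_le_ncard_of_injOn (fun q ↦ Sum.inr q.2) ?_ ?_ (Set.toFinite _)
    · rintro ⟨i', j⟩ hq
      simp only [Finset.coe_filter, Set.mem_ofPred_eq, hnear, Finset.mem_filter, Finset.mem_univ,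
        true_and] at hq ⊢
      obtain ⟨h1, rfl⟩ := hq
      exact h1
    · rintro ⟨i', j⟩ hq ⟨i'', j'⟩ hq' hjj
      simp only [Finset.coe_filter, Set.mem_ofPred_eq] at hq hq'
      simp only [Sum.inr.injEq] at hjj
      rw [Prod.mk.injEq]
      exact ⟨hq.2.trans hq'.2.symm, hjj⟩
  -- The two signs of the absolute value give two half graphs.
  set F : Fin s → Finset (Fin n × Fin n) := fun q ↦
    (Finset.univ.filter fun z ↦ τ ≤ g (Sum.inl z.1) q - g (Sum.inr z.2) q) ∪
    (Finset.univ.filter fun z ↦ τ ≤ -g (Sum.inl z.1) q - -g (Sum.inr z.2) q) with hF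
  have hF_card : ∀ q, (F q).card ≤ 4 * L * n := by
    intro q
    refine (Finset.card_union_le _ _).trans ?_
    have h1 := card_halfGraph_le hL (fun i ↦ g (Sum.inl i) q) (fun j ↦ g (Sum.inr j) q) τ (by
      intro A B hA hB
      obtain ⟨i, hi, j, hj, hij⟩ := hblock A B hA hB
      exact ⟨i, hi, j, hj, not_le.2 (abs_lt.1 (hedge i j hij q)).2⟩)
    have h2 := card_halfGraph_le hL (fun i ↦ -g (Sum.inl i) q) (fun j ↦ -g (Sum.inr j) q) τ (by
      intro A B hA hB
      obtain ⟨i, hi, j, hj, hij⟩ := hblock A B hA hB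
      refine ⟨i, hi, j, hj, not_le.2 ?_⟩
      have := (abs_lt.1 (hedge i j hij q)).1
      linarith)
    calc _ ≤ 2 * L * n + 2 * L * n := add_le_add h1 h2
      _ = _ := by ring
  have hcover : (Finset.univ : Finset (Fin n × Fin n)) ⊆ near ∪ Finset.univ.biUnion F := by
    rintro ⟨i, j⟩ -
    rw [Finset.mem_union]
    by_cases hw : ∃ w : (bipartiteGraph n E).Walk (Sum.inl i) (Sum.inr j), w.length ≤ 2 * k - 1
    · left; simpa [hnear] using hw
    · right
      obtain ⟨q, hq⟩ := hfar i j hw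
      rw [Finset.mem_biUnion]
      refine ⟨q, Finset.mem_univ _, ?_⟩
      rw [hF, Finset.mem_union]
      rcases le_abs.1 hq with h | h
      · left; simpa using h
      · right
        simp only [Finset.mem_filter, Finset.mem_univ, true_and]
        linarith
  have hcount := (Finset.card_le_card hcover).trans (Finset.card_union_le _ _)
  have hbi : (Finset.univ.biUnion F).card ≤ s * (4 * L * n) := by
    refine Finset.card_biUnion_le.trans ?_
    refine (Finset.sum_le_card_nsmul _ _ _ fun q _ ↦ hF_card q).trans (by simp)
  simp only [Finset.card_univ, Fintype.card_prod, Fintype.card_fin] at hcount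
  -- The cover gives `n² ≤ n t^(2k-1) + 4sLn`, and the first term is at most `n²/2`.
  refine Nat.le_of_mul_le_mul_right ?_ hn
  nlinarith

/-! ### Degrees, and numerical estimates -/

lemma bipartiteGraph_ncard_neighborSet_inl {n : ℕ} (E : Set (Fin n × Fin n)) (i : Fin n) :
    ((bipartiteGraph n E).neighborSet (Sum.inl i)).ncard = {j | (i, j) ∈ E}.ncard := by
  rw [← Set.ncard_image_of_injective {j | (i, j) ∈ E} (Sum.inr_injective (α := Fin n))]
  congr 1
  ext x
  simp only [SimpleGraph.mem_neighborSet, bipartiteGraph]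
  aesop

lemma bipartiteGraph_ncard_neighborSet_inr {n : ℕ} (E : Set (Fin n × Fin n)) (j : Fin n) :
    ((bipartiteGraph n E).neighborSet (Sum.inr j)).ncard = {i | (i, j) ∈ E}.ncard := by
  rw [← Set.ncard_image_of_injective {i | (i, j) ∈ E} (Sum.inl_injective (β := Fin n))]
  congr 1
  ext x
  simp only [SimpleGraph.mem_neighborSet, bipartiteGraph]
  aesop

open MeasureTheory in
lemma randomBipartiteEdges_real_large_degree_le (n t : ℕ) (p : unitInterval) :
    (randomBipartiteEdges n p).real
      {E | ∃ x, t ≤ ((bipartiteGraph n E).neighborSet x).ncard}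
      ≤ 2 * n * ((n.choose t : ℝ) * (p : ℝ) ^ t) := by
  have key : ∀ S : Set (Fin n), t ≤ S.ncard → ∃ T : Finset (Fin n), T.card = t ∧ ∀ b ∈ T, b ∈ S := by
    classical
    intro S hS
    rw [Set.ncard_eq_toFinset_card'] at hS
    obtain ⟨T, hT, hTc⟩ := Finset.exists_subset_card_eq hS
    exact ⟨T, hTc, fun b hb ↦ by simpa using hT hb⟩
  have hsub : {E : Set (Fin n × Fin n) | ∃ x, t ≤ ((bipartiteGraph n E).neighborSet x).ncard} ⊆
      (⋃ i : Fin n, {E : Set (Fin n × Fin n) | ∃ T : Finset (Fin n), T.card = t ∧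
        ∀ b ∈ T, (⟨fun j ↦ (i, j), Prod.mk_right_injective i⟩ : Fin n ↪ Fin n × Fin n) b ∈ E}) ∪
      ⋃ j : Fin n, {E : Set (Fin n × Fin n) | ∃ T : Finset (Fin n), T.card = t ∧
        ∀ b ∈ T, (⟨fun i ↦ (i, j), Prod.mk_left_injective j⟩ : Fin n ↪ Fin n × Fin n) b ∈ E} := by
    rintro E ⟨i | j, hx⟩
    · left
      rw [bipartiteGraph_ncard_neighborSet_inl] at hx
      exact Set.mem_iUnion.2 ⟨i, key _ hx⟩
    · right
      rw [bipartiteGraph_ncard_neighborSet_inr] at hx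
      exact Set.mem_iUnion.2 ⟨j, key _ hx⟩
  have hp : IsProbabilityMeasure (randomBipartiteEdges n p) := by
    unfold randomBipartiteEdges; infer_instance
  refine (measureReal_mono hsub).trans ((measureReal_union_le _ _).trans ?_)
  rw [mul_assoc, two_mul]
  refine add_le_add ?_ ?_ <;>
  · refine (measureReal_iUnion_fintype_le _).trans ?_
    refine (Finset.sum_le_card_nsmul _ _ _ fun i _ ↦
      setBernoulli_real_exists_subset_le p _ t).trans ?_
    simp

lemma choose_mul_pow_le {n t : ℕ} {p l : ℝ} (hn : 0 < n) (hl : l = Real.logb 2 n) (hl16 : 16 ≤ l)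
    (hp : 0 ≤ p) (hx : 1 ≤ n * p) (ht : n * p * l ≤ t) :
    2 * (n : ℝ) * ((n.choose t : ℝ) * p ^ t) ≤ 2 / n := by
  have hn' : (0 : ℝ) < n := by exact_mod_cast hn
  have htl : l ≤ t := le_trans (by nlinarith) ht
  have ht0 : (0 : ℝ) < t := by linarith
  have h1 : (n.choose t : ℝ) * p ^ t ≤ (n * p / t * Real.exp 1) ^ t := by
    calc (n.choose t : ℝ) * p ^ t ≤ (n : ℝ) ^ t / (t.factorial : ℝ) * p ^ t := by
          gcongr; exact Nat.choose_le_pow_div t n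
      _ = (n * p / t) ^ t * ((t : ℝ) ^ t / t.factorial) := by
          rw [div_pow, mul_pow]; field_simp
      _ ≤ (n * p / t) ^ t * Real.exp t := by
          gcongr; exact Real.pow_div_factorial_le_exp _ ht0.le t
      _ = _ := by
          rw [mul_pow, ← Real.exp_nat_mul, mul_one]
  -- The ratio is at most `e / l ≤ e / 16`.
  have h2 : n * p / t * Real.exp 1 ≤ 1 / 4 := by
    have he := Real.exp_one_lt_d9
    rw [div_mul_eq_mul_div, div_le_iff₀ ht0]
    nlinarith
  have h3 : (n.choose t : ℝ) * p ^ t ≤ (1 / 4) ^ t :=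
    h1.trans (pow_le_pow_left₀ (by positivity) h2 t)
  have h4 : (n : ℝ) ^ 2 ≤ 4 ^ t := by
    have : (2 : ℝ) ^ l = n := by
      rw [hl]; exact Real.rpow_logb (by norm_num) (by norm_num) hn'
    calc (n : ℝ) ^ 2 = ((2 : ℝ) ^ l) ^ 2 := by rw [this]
      _ ≤ ((2 : ℝ) ^ (t : ℝ)) ^ 2 := by
          gcongr
          norm_num
      _ = 4 ^ t := by
          rw [Real.rpow_natCast, ← pow_mul, mul_comm, pow_mul]; norm_num
  have h5 : (n.choose t : ℝ) * p ^ t ≤ 1 / (n : ℝ) ^ 2 := by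
    refine h3.trans ?_
    rw [one_div_pow]
    exact one_div_le_one_div_of_le (by positivity) h4
  calc 2 * (n : ℝ) * ((n.choose t : ℝ) * p ^ t) ≤ 2 * (n : ℝ) * (1 / (n : ℝ) ^ 2) := by gcongr
    _ = 2 / n := by field_simp

/-- The exponent `2L log n - pL²` is at most `-L log n`. -/
lemma choose_sq_mul_pow_le {n L : ℕ} {p : ℝ} (hn : 0 < n) (hL : 1 ≤ L) (hp1 : p ≤ 1)
    (h : 3 * Real.log n ≤ p * L) :
    (n.choose L : ℝ) ^ 2 * (1 - p) ^ (L ^ 2) ≤ 1 / n := by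
  have hn' : (0 : ℝ) < n := by exact_mod_cast hn
  have hlog : 0 ≤ Real.log n := Real.log_natCast_nonneg n
  have hL' : (1 : ℝ) ≤ L := by exact_mod_cast hL
  calc (n.choose L : ℝ) ^ 2 * (1 - p) ^ (L ^ 2)
      ≤ ((n : ℝ) ^ L) ^ 2 * (Real.exp (-p)) ^ (L ^ 2) := by
        have h0 : 0 ≤ 1 - p := by linarith
        gcongr
        · exact_mod_cast Nat.choose_le_pow n L
        · exact Real.one_sub_le_exp_neg p
    _ = Real.exp (2 * L * Real.log n - p * L * L) := by
        nth_rewrite 1 [← Real.exp_log hn']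
        rw [← Real.exp_nat_mul, ← Real.exp_nat_mul, ← Real.exp_nat_mul, ← Real.exp_add]
        congr 1; push_cast; ring
    _ ≤ Real.exp (-Real.log n) := by
        apply Real.exp_le_exp.2
        nlinarith [mul_le_mul_of_nonneg_right h (by linarith : (0 : ℝ) ≤ L),
          mul_nonneg hlog (by linarith : (0 : ℝ) ≤ L - 1)]
    _ = 1 / n := by rw [Real.exp_neg, Real.exp_log hn', one_div]

/-- An embedding of a metric with two distinct points needs at least one dimension. -/
lemma one_le_dimension {n s : ℕ} {c : ℝ} {E : Set (Fin n × Fin n)} (hn : 0 < n)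
    (g : Fin n ⊕ Fin n → Fin s → ℝ)
    (hg : IsEmbeddingWithDistortion (shortestPathDist (bipartiteGraph n E)) c g) : 1 ≤ s := by
  obtain ⟨r, hr, hg⟩ := hg
  by_contra! hs
  obtain rfl : s = 0 := by omega
  have h := (hg (Sum.inl ⟨0, hn⟩) (Sum.inr ⟨0, hn⟩)).1
  rw [Subsingleton.elim (g (Sum.inl ⟨0, hn⟩)) (g (Sum.inr ⟨0, hn⟩)), edist_self,
    nonpos_iff_eq_zero, mul_eq_zero] at h
  rcases h with h | h
  · exact absurd (ENNReal.ofReal_eq_zero.1 h) (not_le.2 hr)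
  · rw [shortestPathDist, ENat.toENNReal_eq_zero, SimpleGraph.edist_eq_zero_iff] at h
    simp at h

/-- Since `2 / l^4 ≤ 1/2`, already one of the `2k-1` factors absorbs the 2, uniformly in `k`. -/
lemma two_mul_pow_le {n k t : ℕ} {y l : ℝ} (hk : 1 ≤ k) (hl : 16 ≤ l)
    (hyn : y ^ (2 * k - 1) = n) (ht : (t : ℝ) ≤ 2 * y / l ^ 4) : 2 * t ^ (2 * k - 1) ≤ n := by
  have h4 : 4 ≤ l ^ 4 := by
    calc (4 : ℝ) ≤ 16 ^ 4 := by norm_num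
      _ ≤ l ^ 4 := by gcongr
  have hq : 2 / l ^ 4 ≤ 1 / 2 := by
    rw [div_le_div_iff₀ (by linarith) (by norm_num)]; linarith
  have h : 2 * (t : ℝ) ^ (2 * k - 1) ≤ n := by
    calc 2 * (t : ℝ) ^ (2 * k - 1) ≤ 2 * (2 * y / l ^ 4) ^ (2 * k - 1) := by gcongr
      _ = 2 * (n * (2 / l ^ 4) ^ (2 * k - 1)) := by
          rw [← hyn, ← mul_pow]; congr 2; ring
      _ ≤ 2 * (n * (1 / 2)) := by
          gcongr
          refine (pow_le_of_le_one (by positivity) (hq.trans (by norm_num)) (by omega)).trans hq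
      _ = n := by ring
  exact_mod_cast h

/-! ### The theorem -/

theorem theorem3 :
    ∃ B : ℕ, ∀ ε : ℝ, 0 < ε → ∃ C : ℝ, 0 < C ∧
      ∀ η : ℝ, 0 < η → ∃ N : ℕ, ∀ n : ℕ, N ≤ n →
        ∀ k : ℕ, 1 ≤ k → ∀ c : ℝ, (1 + ε) * c ≤ 2 * (k : ℝ) + 1 →
          ∀ p : unitInterval,
            (p : ℝ) = (n : ℝ) ^ (-1 + 1 / (2 * (k : ℝ) - 1)) / Real.logb 2 n ^ 5 →
            1 - η ≤ (randomBipartiteEdges n p).real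
              {E | ∀ (s : ℕ) (g : Fin n ⊕ Fin n → Fin s → ℝ),
                IsEmbeddingWithDistortion (shortestPathDist (bipartiteGraph n E)) c g →
                  C * (n : ℝ) ^ (1 / (2 * (k : ℝ) - 1)) / Real.logb 2 n ^ B ≤ (s : ℝ)} := by
  -- Five logarithms come from `p` and one from `L`. The bound `2^16` gives `l ≥ 16`, and `3 / η`
  -- makes the failure probability `3 / n` at most `η`.
  refine ⟨6, fun ε hε ↦ ⟨1 / 32, by norm_num, fun η hη ↦ ⟨max (2 ^ 16) ⌈3 / η⌉₊, ?_⟩⟩⟩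
  intro n hN k hk c hc p hp
  have hprob : MeasureTheory.IsProbabilityMeasure (randomBipartiteEdges n p) := by
    unfold randomBipartiteEdges; infer_instance
  have hnbig : 2 ^ 16 ≤ n := (le_max_left _ _).trans hN
  have hn : 0 < n := by omega
  have hn' : (0 : ℝ) < n := by exact_mod_cast hn
  have hηn : 3 / (n : ℝ) ≤ η := by
    have : 3 / η ≤ n := (Nat.le_ceil _).trans (by exact_mod_cast (le_max_right _ _).trans hN)
    rw [div_le_iff₀ hη] at this
    rw [div_le_iff₀ hn']; linarith
  -- The only use of `ε`; the constant `C` does not depend on it.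
  have hc' : c < 2 * k + 1 := by
    rcases le_or_gt c 0 with h | h
    · have : (0 : ℝ) ≤ k := k.cast_nonneg
      linarith
    · nlinarith
  set l := Real.logb 2 n with hl
  have hl16 : 16 ≤ l := by
    rw [hl, Real.le_logb_iff_rpow_le (by norm_num) hn']
    norm_num
    exact_mod_cast hnbig
  have hl0 : 0 < l := by linarith
  set y : ℝ := (n : ℝ) ^ (1 / (2 * (k : ℝ) - 1)) with hy
  have hy0 : 0 < y := by positivity
  have hyn : y ^ (2 * k - 1) = n := by
    have hk' : (1 : ℝ) ≤ k := by exact_mod_cast hk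
    have hcast : ((2 * k - 1 : ℕ) : ℝ) = 2 * k - 1 := by
      rw [Nat.cast_sub (by omega)]; push_cast; ring
    rw [hy, ← Real.rpow_natCast, ← Real.rpow_mul hn'.le, hcast,
      one_div_mul_cancel (by linarith), Real.rpow_one]
  have hp' : (p : ℝ) = y / n / l ^ 5 := by
    rw [hp, Real.rpow_add hn', Real.rpow_neg_one]
    congr 1; rw [hy]; ring
  have hp0 : 0 < (p : ℝ) := by rw [hp']; positivity
  have hx : n * (p : ℝ) = y / l ^ 5 := by rw [hp']; field_simp
  have hp1 : (p : ℝ) ≤ 1 := p.2.2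
  -- If `np < 1`, the claimed bound is below 1 and holds for every graph.
  rcases lt_or_ge (n * (p : ℝ)) 1 with hsmall | hlarge
  · have : {E : Set (Fin n × Fin n) | ∀ (s : ℕ) (g : Fin n ⊕ Fin n → Fin s → ℝ),
        IsEmbeddingWithDistortion (shortestPathDist (bipartiteGraph n E)) c g →
          1 / 32 * y / l ^ 6 ≤ (s : ℝ)} = Set.univ := by
      refine Set.eq_univ_of_forall fun E s g hg ↦ ?_
      have h1 : (1 : ℝ) ≤ s := by exact_mod_cast one_le_dimension hn g hg
      refine le_trans ?_ h1
      rw [hx, div_lt_one (by positivity)] at hsmall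
      rw [div_le_one (by positivity), pow_succ]
      nlinarith [pow_pos hl0 5]
    rw [this, MeasureTheory.probReal_univ]
    linarith
  set t := ⌈n * (p : ℝ) * l⌉₊ with ht
  set L := ⌈3 * l / (p : ℝ)⌉₊ with hL
  have hL1 : 1 ≤ L := Nat.ceil_pos.2 (by positivity)
  have ht_le : (t : ℝ) ≤ 2 * y / l ^ 4 := by
    have h1 : (t : ℝ) ≤ n * p * l + 1 := (Nat.ceil_lt_add_one (by positivity)).le
    have h2 : 2 * y / l ^ 4 = 2 * (n * p * l) := by rw [hx]; field_simp
    nlinarith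
  have hL_le : (L : ℝ) * p ≤ 4 * l := by
    have h1 : (L : ℝ) ≤ 3 * l / p + 1 := (Nat.ceil_lt_add_one (by positivity)).le
    have h2 : (L : ℝ) * p ≤ (3 * l / p + 1) * p := by gcongr
    have h3 : (3 * l / p + 1) * (p : ℝ) = 3 * l + p := by field_simp
    linarith
  have hlog : Real.log n ≤ l := by
    have h1 : Real.log n = l * Real.log 2 := by
      rw [hl, Real.logb, div_mul_cancel₀ _ (Real.log_pos (by norm_num)).ne']
    have h2 : Real.log 2 ≤ 1 := Real.log_two_lt_d9.le.trans (by norm_num)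
    rw [h1]; nlinarith
  have hb1 := (randomBipartiteEdges_real_large_degree_le n t p).trans
    (choose_mul_pow_le hn hl hl16 hp0.le hlarge (Nat.le_ceil _))
  have hb2 := (randomBipartiteEdges_real_empty_block_le n L p).trans
    (choose_sq_mul_pow_le hn hL1 hp1 (by
      have h1 : 3 * l / (p : ℝ) ≤ L := Nat.le_ceil _
      rw [div_le_iff₀ hp0] at h1
      linarith))
  set D := {E : Set (Fin n × Fin n) | ∃ x, t ≤ ((bipartiteGraph n E).neighborSet x).ncard} with hD
  set F := {E : Set (Fin n × Fin n) | ∃ A B : Finset (Fin n), A.card = L ∧ B.card = L ∧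
    ∀ i ∈ A, ∀ j ∈ B, (i, j) ∉ E} with hF
  set S := {E : Set (Fin n × Fin n) | ∀ (s : ℕ) (g : Fin n ⊕ Fin n → Fin s → ℝ),
        IsEmbeddingWithDistortion (shortestPathDist (bipartiteGraph n E)) c g →
          1 / 32 * y / l ^ 6 ≤ (s : ℝ)} with hS
  -- A cover of the whole space, rather than complements, needs only subadditivity, so `S` need not
  -- be shown measurable.
  have hcover : Set.univ ⊆ S ∪ (D ∪ F) := by
    intro E _
    by_cases hED : E ∈ D
    · exact Or.inr (Or.inl hED)
    by_cases hEF : E ∈ F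
    · exact Or.inr (Or.inr hEF)
    refine Or.inl fun s g hg ↦ ?_
    simp only [hD, Set.mem_ofPred_eq, not_exists, not_le] at hED
    have hblock : ∀ A B : Finset (Fin n), A.card = L → B.card = L →
        ∃ i ∈ A, ∃ j ∈ B, (i, j) ∈ E := by
      intro A B hA hB
      by_contra! hcon
      exact hEF ⟨A, B, hA, hB, hcon⟩
    have hdim := dimension_lower_bound hk hc' hL1 hED hblock
      (two_mul_pow_le hk hl16 hyn ht_le) g hg
    have hdim' : (n : ℝ) ≤ s * (8 * L) := by exact_mod_cast hdim
    have h1 : n * (p : ℝ) ≤ s * (32 * l) := by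
      calc n * (p : ℝ) ≤ s * (8 * L) * p := by gcongr
        _ = s * (8 * (L * p)) := by ring
        _ ≤ s * (8 * (4 * l)) := by gcongr
        _ = s * (32 * l) := by ring
    rw [hx, div_le_iff₀ (by positivity)] at h1
    rw [div_le_iff₀ (by positivity)]
    linarith [show (s : ℝ) * (32 * l) * l ^ 5 = 32 * (s * l ^ 6) by ring]
  have hfin : 1 ≤ (randomBipartiteEdges n p).real S + (2 / n + 1 / n) := by
    calc (1 : ℝ) = (randomBipartiteEdges n p).real Set.univ := MeasureTheory.probReal_univ.symm
      _ ≤ (randomBipartiteEdges n p).real (S ∪ (D ∪ F)) := MeasureTheory.measureReal_mono hcover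
      _ ≤ _ := (MeasureTheory.measureReal_union_le _ _).trans
          (add_le_add_right ((MeasureTheory.measureReal_union_le _ _).trans (add_le_add hb1 hb2)) _)
  have h3 : 2 / (n : ℝ) + 1 / n = 3 / n := by ring
  linarith
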